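/- Let $G_1=\langle X_1\mid R_1\rangle$ and $G_2=\langle X_2\mid R_2\rangle$ be finite groups given by finite presentations on disjoint alphabets, let $A$ be a group with monomorphisms $\phi_i:A\to G_i$ ($i=1,2$), let $G=G_1*_A G_2$ be the corresponding amalgam, and put $X=X_1\sqcup X_2$. For a subgroup $H\le G$, let $Cayley(G,H)$ be the relative Cayley graph: its vertices are the right cosets $Hg$, and for each letter $x\in X^{\pm}$ (where $X^{\pm}$ consists of the letters of $X$ and their formal inverses) there is an edge $(Hg,x)$ with label $x$ from $Hg$ to $Hgx$, whose inverse edge is $(Hgx,x^{-1})$. Call a path in $Cayley(G,H)$ normal if, writing its label as $w_1w_2\cdots w_n$ ($n\ge 0$) with the $w_k$ its maximal nonempty subwords over a single alphabet $X_1^{\pm}$ or $X_2^{\pm}$, every $w_k$ represents a nontrivial element of $G$ and, if $n\neq 1$, no $w_k$ represents an element of $A$. The normal core of $Cayley(G,H)$ is the full subgraph of $Cayley(G,H)$ spanned by the essential vertices, i.e. those lying on some normal path which starts and ends at the vertex $H\cdot 1$. If $H$ is a finitely generated subgroup of $G$, then the normal core of $Cayley(G,H)$ is a finite graph (it has finitely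 many vertices and finitely many edges). -/

import Mathlib

/-- A graph in the sense of Serre, labelled with `X^± = X × Bool`
(`(x, true)` stands for `x` and `(x, false)` for its formal inverse). -/
structure LabelledGraph (X : Type*) where
  V : Type*
  E : Type*
  init : E → V
  rev : E → E
  rev_rev : ∀ e, rev (rev e) = e
  rev_ne : ∀ e, rev e ≠ e
  lab : E → X × Bool
  lab_rev : ∀ e, lab (rev e) = ((lab e).1, !(lab e).2)

namespace LabelledGraph

variable {X : Type*}

/-- The terminal vertex of an edge. -/
def term (Γ : LabelledGraph X) (e : Γ.E) : Γ.V := Γ.init (Γ.rev e)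

/-- `Γ.IsPath v p w`: the sequence of edges `p` is a path from `v` to `w`. -/
def IsPath (Γ : LabelledGraph X) : Γ.V → List Γ.E → Γ.V → Prop
  | v, [], w => v = w
  | v, e :: p, w => Γ.init e = v ∧ Γ.IsPath (Γ.term e) p w

/-- The vertices through which the path `p` starting at `v` goes (endpoints included). -/
def pathVertices (Γ : LabelledGraph X) (v : Γ.V) (p : List Γ.E) : List Γ.V :=
  v :: p.map Γ.term

/-- The label of a path, a word over `X^±`. -/
def pathLabel (Γ : LabelledGraph X) (p : List Γ.E) : List (X × Bool) := p.map Γ.lab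

theorem init_rev (Γ : LabelledGraph X) (e : Γ.E) : Γ.init (Γ.rev e) = Γ.term e := rfl

theorem term_rev (Γ : LabelledGraph X) (e : Γ.E) : Γ.term (Γ.rev e) = Γ.init e := by
  rw [term, Γ.rev_rev]

/-- The restriction of a graph to a set `S` of vertices: all the vertices in `S`, and all the
edges with both endpoints in `S`. -/
def restrict (Γ : LabelledGraph X) (S : Set Γ.V) : LabelledGraph X where
  V := S
  E := {e : Γ.E // Γ.init e ∈ S ∧ Γ.term e ∈ S}
  init e := ⟨Γ.init e.1, e.2.1⟩
  rev e := ⟨Γ.rev e.1, by rw [init_rev]; exact e.2.2, by rw [term_rev]; exact e.2.1⟩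
  rev_rev e := Subtype.ext (Γ.rev_rev e.1)
  rev_ne e h := Γ.rev_ne e.1 (congrArg Subtype.val h)
  lab e := Γ.lab e.1
  lab_rev e := Γ.lab_rev e.1

/-- A graph is finite if it has finitely many vertices and finitely many edges. -/
def IsFinite (Γ : LabelledGraph X) : Prop := Finite Γ.V ∧ Finite Γ.E

end LabelledGraph

section Cayley

variable {X G : Type*} [Group G]

/-- `G = gp⟨X | R⟩`, where `x` sends each letter of `X` to the element of `G` it denotes. -/
def IsPresentation (x : X → G) (R : Set (FreeGroup X)) : Prop :=
  Function.Surjective (FreeGroup.lift x) ∧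
    (FreeGroup.lift x).ker = Subgroup.normalClosure R

/-- The element of `G` denoted by a letter of `X^±`. -/
def letterVal (x : X → G) (a : X × Bool) : G := if a.2 then x a.1 else (x a.1)⁻¹

/-- The element of `G` denoted by a word over `X^±`. -/
def wordVal (x : X → G) (w : List (X × Bool)) : G := (w.map (letterVal x)).prod

/-- The right cosets `Hg` of `H` in `G`. -/
abbrev RightCosets (H : Subgroup G) : Type _ := Quotient (QuotientGroup.rightRel H)

/-- `Hg ↦ Hgk`. -/
def RightCosets.mulRight {H : Subgroup G} (c : RightCosets H) (k : G) : RightCosets H :=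
  Quotient.map' (· * k) (fun a b h => by
    rw [QuotientGroup.rightRel_apply] at h ⊢
    simpa [mul_assoc] using h) c

theorem RightCosets.mulRight_mulRight {H : Subgroup G} (c : RightCosets H) (k l : G) :
    (c.mulRight k).mulRight l = c.mulRight (k * l) := by
  induction c using Quotient.inductionOn'
  simp [RightCosets.mulRight, mul_assoc]

theorem RightCosets.mulRight_one {H : Subgroup G} (c : RightCosets H) : c.mulRight 1 = c := by
  induction c using Quotient.inductionOn'
  simp [RightCosets.mulRight]

theorem letterVal_mul_inv (x : X → G) (a : X × Bool) :
    letterVal x a * letterVal x (a.1, !a.2) = 1 := by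
  rcases a with ⟨a, _ | _⟩ <;> simp [letterVal]

/-- The relative Cayley graph `Cayley(G, H)` with respect to the generators `x`: the vertices are
the right cosets of `H`, and the edge `(Hg, a)`, `a ∈ X^±`, is labelled by `a`, begins at `Hg` and
ends at `Hga`. -/
def relCayley (x : X → G) (H : Subgroup G) : LabelledGraph X where
  V := RightCosets H
  E := RightCosets H × (X × Bool)
  init e := e.1
  rev e := (e.1.mulRight (letterVal x e.2), (e.2.1, !e.2.2))
  rev_rev e := by
    simp [RightCosets.mulRight_mulRight, letterVal_mul_inv, RightCosets.mulRight_one]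
  rev_ne e h := by
    have := congrArg (fun t => t.2.2) h
    simp at this
  lab e := e.2
  lab_rev _ := rfl

theorem relCayley_term (x : X → G) (H : Subgroup G) (c : RightCosets H) (a : X × Bool) :
    (relCayley x H).term (c, a) = c.mulRight (letterVal x a) := rfl

/-- The basepoint `H · 1` of `Cayley(G, H)`. -/
def relCayley.base (x : X → G) (H : Subgroup G) : (relCayley x H).V :=
  (Quotient.mk'' (1 : G) : RightCosets H)

end Cayley

section Amalgam

open Monoid

variable {A : Type*} [Group A] {G : Fin 2 → Type*} [∀ i, Group (G i)]
  {X : Fin 2 → Type*}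

/-- The letters of the disjoint union `X = X₁ ∪ X₂` as elements of the amalgam `G₁ *_A G₂`. -/
def amalgamGen (φ : ∀ i, A →* G i) (x : ∀ i, X i → G i) (a : Σ i, X i) : PushoutI φ :=
  PushoutI.of a.1 (x a.1 a.2)

/-- The sequence `(g₁, …, gₙ)` of elements of the amalgam `G₁ *_A G₂` is in normal form. -/
structure IsNormalSeq (φ : ∀ i, A →* G i) (gs : List (PushoutI φ)) : Prop where
  ne_one : ∀ g ∈ gs, g ≠ 1
  mem_factor : ∀ g ∈ gs, ∃ i, g ∈ (PushoutI.of (φ := φ) i).range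
  alternate : gs.IsChain fun g h => ∃ i j, i ≠ j ∧
    g ∈ (PushoutI.of (φ := φ) i).range ∧ h ∈ (PushoutI.of (φ := φ) j).range
  notMem_base : gs.length ≠ 1 → ∀ g ∈ gs, g ∉ (PushoutI.base φ).range

/-- `L` is the decomposition of the word `w` over `X₁^± ∪ X₂^±` into its maximal monochromatic
subwords: the words in `L` are nonempty, all the letters of each have the same colour, and
neighbouring words have different colours. -/
def IsMonochromaticDecomp (w : List ((Σ i, X i) × Bool)) (L : List (List ((Σ i, X i) × Bool))) :
    Prop :=
  L.flatten = w ∧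
  (∀ u ∈ L, u ≠ [] ∧ ∃ i, ∀ a ∈ u, a.1.1 = i) ∧
  L.IsChain fun u v => ∀ a ∈ u, ∀ b ∈ v, a.1.1 ≠ b.1.1

/-- A word over `X₁^± ∪ X₂^±` is in normal form if the elements of `G₁ *_A G₂` denoted by its
maximal monochromatic subwords form a sequence in normal form. -/
def IsNormalWord (φ : ∀ i, A →* G i) (x : ∀ i, X i → G i) (w : List ((Σ i, X i) × Bool)) : Prop :=
  ∃ L, IsMonochromaticDecomp w L ∧ IsNormalSeq φ (L.map (wordVal (amalgamGen φ x)))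

/-- A vertex of `Cayley(G, H)` is essential if some normal path closed at `H · 1` goes through
it. -/
def IsEssential (φ : ∀ i, A →* G i) (x : ∀ i, X i → G i) (H : Subgroup (PushoutI φ))
    (v : (relCayley (amalgamGen φ x) H).V) : Prop :=
  ∃ p : List (relCayley (amalgamGen φ x) H).E,
    (relCayley (amalgamGen φ x) H).IsPath (relCayley.base _ H) p (relCayley.base _ H) ∧
    IsNormalWord φ x ((relCayley (amalgamGen φ x) H).pathLabel p) ∧
    v ∈ (relCayley (amalgamGen φ x) H).pathVertices (relCayley.base _ H) p

/-- The normal core of `Cayley(G, H)`: its restriction to the set of the essential vertices. -/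
def normalCore (φ : ∀ i, A →* G i) (x : ∀ i, X i → G i) (H : Subgroup (PushoutI φ)) :
    LabelledGraph (Σ i, X i) :=
  (relCayley (amalgamGen φ x) H).restrict {v | IsEssential φ x H v}

/-- The empty path is normal, so the basepoint is a vertex of the normal core. -/
theorem isEssential_base (φ : ∀ i, A →* G i) (x : ∀ i, X i → G i) (H : Subgroup (PushoutI φ)) :
    IsEssential φ x H (relCayley.base _ H) := by
  refine ⟨[], rfl, ⟨[], ⟨rfl, by simp, by simp⟩, ⟨?_, ?_, ?_, ?_⟩⟩, ?_⟩ <;>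
    simp [LabelledGraph.pathVertices]

/-- The basepoint of the normal core. -/
def normalCore.base (φ : ∀ i, A →* G i) (x : ∀ i, X i → G i) (H : Subgroup (PushoutI φ)) :
    (normalCore φ x H).V :=
  ⟨relCayley.base _ H, isEssential_base φ x H⟩

end Amalgam

/-! ### Words, and prefixes of path labels. -/

section WordValues

variable {X G : Type*} [Group G]

/-! The cosets `gA` are the edges of the Bass-Serre tree of the amalgam. Multiplying on the right by
a factor element moves to an edge sharing an endpoint, and a reduced sequence runs along a geodesic.
In a tree every walk crosses each edge of the geodesic between its ends, so any walk from `1` to `h`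
meets, up to `A`, all prefix products of a reduced form of `h` (`FactorStep.exists_of_prefix`).

Translating walks to the finitely many generators of `H` joins `1` to every `h ∈ H` inside `HD` with
`D` finite (`exists_finite_cosets_reflTransGen`). An essential vertex is `Hl` for a prefix `l` of a
normal word with value in `H`: the complete syllables of `l` contribute an element of `HDA`, and the
last, possibly partial, one an element of a factor. As `D`, `A` and the factors are finite, few
enough cosets arise. -/

theorem wordVal_nil (x : X → G) : wordVal x [] = 1 := rfl

theorem wordVal_cons (x : X → G) (a : X × Bool) (w : List (X × Bool)) :
    wordVal x (a :: w) = letterVal x a * wordVal x w := by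
  simp [wordVal]

theorem wordVal_append (x : X → G) (u v : List (X × Bool)) :
    wordVal x (u ++ v) = wordVal x u * wordVal x v := by
  simp [wordVal]

theorem wordVal_flatten (x : X → G) (L : List (List (X × Bool))) :
    wordVal x L.flatten = (L.map (wordVal x)).prod := by
  induction L with
  | nil => rfl
  | cons u L ih => simp [wordVal_append, ih]

/-- In the relative Cayley graph, a path ends at the translate of its origin by its label. -/
theorem relCayley_isPath_end (x : X → G) (H : Subgroup G) {p : List (relCayley x H).E}
    {c d : RightCosets H} (hp : (relCayley x H).IsPath c p d) :
    d = c.mulRight (wordVal x ((relCayley x H).pathLabel p)) := by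
  induction p generalizing c with
  | nil => exact hp.symm.trans (RightCosets.mulRight_one c).symm
  | cons e p ih =>
    obtain ⟨rfl, hp⟩ := hp
    refine (ih hp).trans ?_
    exact RightCosets.mulRight_mulRight e.1 (letterVal x e.2) _

/-- In the relative Cayley graph, each vertex of a path is the translate of its origin by a prefix
of its label. -/
theorem relCayley_exists_prefix (x : X → G) (H : Subgroup G) {p : List (relCayley x H).E}
    {c d v : RightCosets H} (hp : (relCayley x H).IsPath c p d)
    (hv : v ∈ (relCayley x H).pathVertices c p) :
    ∃ l, l <+: (relCayley x H).pathLabel p ∧ v = c.mulRight (wordVal x l) := by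
  induction p generalizing c with
  | nil =>
    have hv : v = c := List.mem_singleton.1 hv
    exact ⟨[], List.nil_prefix, hv.trans (RightCosets.mulRight_one c).symm⟩
  | cons e p ih =>
    obtain ⟨rfl, hp⟩ := hp
    rcases List.mem_cons.1 hv with hv | hv
    · exact ⟨[], List.nil_prefix, hv.trans (RightCosets.mulRight_one _).symm⟩
    · obtain ⟨l, hl, rfl⟩ := ih hp hv
      refine ⟨e.2 :: l, List.cons_prefix_cons.2 ⟨rfl, hl⟩, ?_⟩
      rw [wordVal_cons]
      exact RightCosets.mulRight_mulRight e.1 (letterVal x e.2) _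

end WordValues

/-- A nonempty prefix of a concatenation consists of some of the pieces followed by a prefix of
the next piece. -/
theorem List.IsPrefix.exists_of_flatten {α : Type*} {l : List α} {L : List (List α)}
    (hl : l <+: L.flatten) :
    l = [] ∨ ∃ L' u v, L' ++ [u] <+: L ∧ v <+: u ∧ l = L'.flatten ++ v := by
  induction L generalizing l with
  | nil => exact Or.inl (by simpa using hl)
  | cons w L ih =>
    right
    rw [List.flatten_cons] at hl
    rcases List.prefix_or_prefix_of_prefix hl (List.prefix_append w L.flatten) with h | ⟨t, rfl⟩
    · exact ⟨[], w, l, by simp, h, by simp⟩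
    · rcases ih ((List.prefix_append_right_inj w).1 hl) with rfl | ⟨L', u, v, hL, hv, rfl⟩
      · exact ⟨[], w, w, by simp, List.prefix_rfl, by simp⟩
      · exact ⟨w :: L', u, v, by simpa using hL, hv, by simp⟩

/-! ### Reduced sequences and walks in the amalgam. -/

section Amalgam

open Monoid Relation

variable {A : Type*} [Group A] {ι : Type*} {G : ι → Type*} [∀ i, Group (G i)]

/-- The product in the amalgam of a sequence of elements of the factors. -/
def amalgamProd (φ : ∀ i, A →* G i) (gs : List (Σ i, G i)) : PushoutI φ :=
  (gs.map fun g => PushoutI.of g.1 g.2).prod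

@[simp]
theorem amalgamProd_nil (φ : ∀ i, A →* G i) : amalgamProd φ [] = 1 := rfl

@[simp]
theorem amalgamProd_cons (φ : ∀ i, A →* G i) (g : Σ i, G i) (gs : List (Σ i, G i)) :
    amalgamProd φ (g :: gs) = PushoutI.of g.1 g.2 * amalgamProd φ gs := by
  simp [amalgamProd]

/-- A sequence of elements of the factors is reduced if neighbours lie in different factors and no
element lies in the amalgamated subgroup. -/
structure IsReducedSeq (φ : ∀ i, A →* G i) (gs : List (Σ i, G i)) : Prop where
  chain_ne : gs.IsChain fun g h => g.1 ≠ h.1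
  notMem_range : ∀ g ∈ gs, g.2 ∉ (φ g.1).range

namespace IsReducedSeq

variable {φ : ∀ i, A →* G i} {gs : List (Σ i, G i)} {i j : ι}

/-- The normal form theorem for amalgams: a nonempty reduced word never represents an element of
`A`, in particular not `1`. -/
theorem eq_nil_of_prod_eq_one (hφ : ∀ i, Function.Injective (φ i)) (h : IsReducedSeq φ gs)
    (h1 : amalgamProd φ gs = 1) : gs = [] := by
  let w : CoprodI.Word G :=
    ⟨gs, fun g hg h1 => h.notMem_range g hg (h1 ▸ one_mem _), h.chain_ne⟩
  have hw : PushoutI.Reduced φ w := h.notMem_range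
  have hprod : PushoutI.ofCoprodI w.prod = amalgamProd φ gs := by
    simp [w, CoprodI.Word.prod, amalgamProd, map_list_prod, Function.comp_def]
  have := hw.eq_empty_of_mem_range hφ (by rw [hprod, h1]; exact one_mem _)
  exact congrArg CoprodI.Word.toList this

theorem tail {g : Σ i, G i} (h : IsReducedSeq φ (g :: gs)) : IsReducedSeq φ gs :=
  ⟨h.chain_ne.tail, fun k hk => h.notMem_range k (List.mem_cons_of_mem _ hk)⟩

/-- This and the next two lemmas keep the sequence reduced when a walk step is cancelled from its
front. -/
theorem replace_head {g g' : G i} (h : IsReducedSeq φ (⟨i, g⟩ :: gs))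
    (hg : g' ∉ (φ i).range) : IsReducedSeq φ (⟨i, g'⟩ :: gs) := by
  refine ⟨?_, ?_⟩
  · have := h.chain_ne
    cases gs with
    | nil => simp
    | cons k gs => simpa using this
  · intro k hk
    rcases List.mem_cons.1 hk with rfl | hk
    · exact hg
    · exact h.tail.notMem_range k hk

theorem base_mul_head {g : G i} (h : IsReducedSeq φ (⟨i, g⟩ :: gs)) (α : A) :
    IsReducedSeq φ (⟨i, φ i α * g⟩ :: gs) := by
  refine h.replace_head fun hg => h.notMem_range ⟨i, g⟩ List.mem_cons_self ?_
  exact ((φ i).range.mul_mem_cancel_left ⟨α, rfl⟩).1 hg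

theorem cons {g : G i} {k : G j} (h : IsReducedSeq φ (⟨j, k⟩ :: gs))
    (hij : i ≠ j) (hg : g ∉ (φ i).range) : IsReducedSeq φ (⟨i, g⟩ :: ⟨j, k⟩ :: gs) := by
  refine ⟨List.isChain_cons_cons.2 ⟨hij, h.chain_ne⟩, ?_⟩
  intro k hk
  rcases List.mem_cons.1 hk with rfl | hk
  · exact hg
  · exact h.notMem_range k hk

end IsReducedSeq

/-- Two elements of `C` that differ by right multiplication by an element of a factor. -/
def FactorStep (φ : ∀ i, A →* G i) (C : Set (PushoutI φ)) (a b : PushoutI φ) : Prop :=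
  a ∈ C ∧ b ∈ C ∧ ∃ i, ∃ t : G i, b = a * PushoutI.of i t

namespace FactorStep

variable {φ : ∀ i, A →* G i} {C D : Set (PushoutI φ)} {a b : PushoutI φ}

theorem symm (h : FactorStep φ C a b) : FactorStep φ C b a := by
  obtain ⟨ha, hb, i, t, rfl⟩ := h
  exact ⟨hb, ha, i, t⁻¹, by simp⟩

theorem reflTransGen_symm (h : ReflTransGen (FactorStep φ C) a b) :
    ReflTransGen (FactorStep φ C) b a := by
  induction h with
  | refl => exact ReflTransGen.refl
  | tail _ h ih => exact ReflTransGen.head h.symm ih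

theorem mul_left (g : PushoutI φ) (hCD : ∀ c ∈ C, g * c ∈ D) (h : FactorStep φ C a b) :
    FactorStep φ D (g * a) (g * b) := by
  obtain ⟨ha, hb, i, t, rfl⟩ := h
  exact ⟨hCD _ ha, hCD _ hb, i, t, (mul_assoc _ _ _).symm⟩

theorem reflTransGen_mul_left (g : PushoutI φ) (hCD : ∀ c ∈ C, g * c ∈ D)
    (h : ReflTransGen (FactorStep φ C) a b) :
    ReflTransGen (FactorStep φ D) (g * a) (g * b) := by
  induction h with
  | refl => exact ReflTransGen.refl
  | tail _ h ih => exact ih.tail (h.mul_left g hCD)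

theorem reflTransGen_mono (hCD : C ⊆ D) (h : ReflTransGen (FactorStep φ C) a b) :
    ReflTransGen (FactorStep φ D) a b := by
  simpa using reflTransGen_mul_left 1 (fun c hc => by simpa using hCD hc) h

/-- Each element of the amalgam is joined to the identity within some finite set. -/
theorem exists_finite_reflTransGen [Nonempty ι] (g : PushoutI φ) :
    ∃ D : Set (PushoutI φ), D.Finite ∧ ReflTransGen (FactorStep φ D) 1 g := by
  have of_mem : ∀ i (t : G i), ∃ D : Set (PushoutI φ),
      D.Finite ∧ ReflTransGen (FactorStep φ D) 1 (PushoutI.of i t) := fun i t =>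
    ⟨{1, PushoutI.of i t}, by simp, ReflTransGen.single ⟨by simp, by simp, i, t, by simp⟩⟩
  induction g using PushoutI.induction_on with
  | of i t => exact of_mem i t
  | base α =>
    obtain ⟨i⟩ := ‹Nonempty ι›
    rw [← PushoutI.of_apply_eq_base φ i]
    exact of_mem i _
  | mul g k hg hk =>
    obtain ⟨D, hD, hg⟩ := hg
    obtain ⟨E, hE, hk⟩ := hk
    refine ⟨D ∪ (g * ·) '' E, hD.union (hE.image _), ?_⟩
    refine (reflTransGen_mono Set.subset_union_left hg).trans ?_
    simpa using reflTransGen_mul_left g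
      (fun c hc => Set.mem_union_right D (Set.mem_image_of_mem (g * ·) hc)) hk

/-- If `a` is joined to `b` within `C`, then the path from `a` to `b` given by a reduced sequence
stays in `C`, up to elements of the amalgamated subgroup. -/
theorem exists_of_prefix (hφ : ∀ i, Function.Injective (φ i)) (ha : a ∈ C)
    (h : ReflTransGen (FactorStep φ C) a b) {gs l : List (Σ i, G i)} (hgs : IsReducedSeq φ gs)
    (hab : a * amalgamProd φ gs = b) (hl : l <+: gs) :
    ∃ c ∈ C, ∃ α, a * amalgamProd φ l = c * PushoutI.base φ α := by
  -- Induct on the walk. After the step `t`, the remaining sequence represents `t⁻¹` times the old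
  -- product; the cases say how `t⁻¹` merges with the first syllable `g`.
  induction h using ReflTransGen.head_induction_on generalizing gs l with
  | refl =>
    obtain rfl := hgs.eq_nil_of_prod_eq_one hφ (by simpa using hab)
    obtain rfl := List.prefix_nil.1 hl
    exact ⟨b, ha, 1, by simp⟩
  | head hstep _ ih =>
    obtain ⟨-, ha', i, t, rfl⟩ := hstep
    rename_i a _
    rcases gs with _ | ⟨⟨j, g⟩, gs⟩
    · obtain rfl := List.prefix_nil.1 hl
      exact ⟨a, ha, 1, by simp⟩
    rcases l with _ | ⟨k, l⟩
    · exact ⟨a, ha, 1, by simp⟩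
    obtain ⟨rfl, hl'⟩ := List.cons_prefix_cons.1 hl
    -- If `t` lies in `A`, the first syllable absorbs its inverse.
    by_cases ht : t ∈ (φ i).range
    · obtain ⟨α, rfl⟩ := ht
      have key : ∀ m, a * PushoutI.of i (φ i α) * amalgamProd φ (⟨j, φ j α⁻¹ * g⟩ :: m) =
          a * amalgamProd φ (⟨j, g⟩ :: m) := fun m => by
        simp [PushoutI.of_apply_eq_base, mul_assoc]
      rw [← key] at hab ⊢
      exact ih ha' (hgs.base_mul_head α⁻¹) hab (List.cons_prefix_cons.2 ⟨rfl, hl'⟩)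
    · rcases eq_or_ne i j with rfl | hij
      · by_cases htg : t⁻¹ * g ∈ (φ i).range
        · obtain ⟨α, hα⟩ := htg
          have hg : a * PushoutI.of i g = a * PushoutI.of i t * PushoutI.base φ α := by
            rw [← PushoutI.of_apply_eq_base φ i, hα]
            simp
          rcases l with _ | ⟨k, l⟩
          · exact ⟨_, ha', α, by simpa using hg⟩
          rcases gs with _ | ⟨⟨j, g'⟩, gs⟩
          · simp at hl'
          obtain ⟨rfl, hl''⟩ := List.cons_prefix_cons.1 hl'
          have key : ∀ m, a * PushoutI.of i t * amalgamProd φ (⟨j, φ j α * g'⟩ :: m) =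
              a * amalgamProd φ (⟨i, g⟩ :: ⟨j, g'⟩ :: m) := fun m => by
            simp only [amalgamProd_cons, map_mul, PushoutI.of_apply_eq_base, ← mul_assoc, hg]
          rw [← key] at hab ⊢
          exact ih ha' (hgs.tail.base_mul_head α) hab (List.cons_prefix_cons.2 ⟨rfl, hl''⟩)
        · have key : ∀ m, a * PushoutI.of i t * amalgamProd φ (⟨i, t⁻¹ * g⟩ :: m) =
              a * amalgamProd φ (⟨i, g⟩ :: m) := fun m => by
            simp [mul_assoc]
          rw [← key] at hab ⊢
          exact ih ha' (hgs.replace_head htg) hab (List.cons_prefix_cons.2 ⟨rfl, hl'⟩)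
      -- The walk leaves through the other side of the tree: `t⁻¹` becomes a new first syllable, and
      -- the prefix grows by one.
      · have key : ∀ m, a * PushoutI.of i t * amalgamProd φ (⟨i, t⁻¹⟩ :: ⟨j, g⟩ :: m) =
            a * amalgamProd φ (⟨j, g⟩ :: m) := fun m => by
          simp [mul_assoc]
        rw [← key] at hab ⊢
        refine ih ha' (hgs.cons hij fun h => ht (inv_mem_iff.1 h)) hab ?_
        exact List.cons_prefix_cons.2 ⟨rfl, List.cons_prefix_cons.2 ⟨rfl, hl'⟩⟩

end FactorStep

/-- The elements of a finitely generated subgroup `H` are joined to the identity within the union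
of finitely many right cosets of `H`. -/
theorem exists_finite_cosets_reflTransGen [Nonempty ι] {φ : ∀ i, A →* G i}
    {H : Subgroup (PushoutI φ)} (hH : H.FG) :
    ∃ D : Set (PushoutI φ), D.Finite ∧ 1 ∈ D ∧
      ∀ h ∈ H, ReflTransGen (FactorStep φ {c | ∃ k ∈ H, ∃ d ∈ D, c = k * d}) 1 h := by
  obtain ⟨S, rfl⟩ := hH
  choose D hD hpath using FactorStep.exists_finite_reflTransGen (φ := φ)
  refine ⟨insert 1 (⋃ s ∈ S, D s),
    (S.finite_toSet.biUnion fun s _ => hD s).insert 1, Set.mem_insert _ _, ?_⟩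
  set H := Subgroup.closure (S : Set (PushoutI φ))
  set C : Set (PushoutI φ) := {c | ∃ k ∈ H, ∃ d ∈ insert 1 (⋃ s ∈ S, D s), c = k * d}
  -- Because `C = HD` is invariant under left translation by `H`, walks in it can be translated and
  -- concatenated, or translated and reversed.
  have hC : ∀ h ∈ H, ∀ c ∈ C, h * c ∈ C := by
    rintro h hh _ ⟨k, hk, d, hd, rfl⟩
    exact ⟨h * k, mul_mem hh hk, d, hd, (mul_assoc _ _ _).symm⟩
  intro h hh
  induction hh using Subgroup.closure_induction with
  | mem s hs =>
    refine FactorStep.reflTransGen_mono (fun d hd => ⟨1, one_mem _, d, ?_, by simp⟩) (hpath s)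
    exact Set.mem_insert_of_mem _ (Set.mem_biUnion hs hd)
  | one => exact ReflTransGen.refl
  | mul a b ha _ iha ihb =>
    exact iha.trans (by simpa using FactorStep.reflTransGen_mul_left a (hC a ha) ihb)
  | inv a ha iha =>
    simpa using FactorStep.reflTransGen_symm
      (FactorStep.reflTransGen_mul_left a⁻¹ (hC _ (inv_mem ha)) iha)

end Amalgam

/-! ### Finiteness of the normal core. -/

section NormalCore

open Monoid

variable {A : Type*} [Group A] {G : Fin 2 → Type*} [∀ i, Group (G i)] {X : Fin 2 → Type*}

/-- A word over the letters of one factor denotes an element of that factor. -/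
theorem exists_wordVal_eq_of (φ : ∀ i, A →* G i) (x : ∀ i, X i → G i) {i : Fin 2}
    {w : List ((Σ i, X i) × Bool)} (hw : ∀ a ∈ w, a.1.1 = i) :
    ∃ g : G i, wordVal (amalgamGen φ x) w = PushoutI.of i g := by
  induction w with
  | nil => exact ⟨1, by simp [wordVal_nil]⟩
  | cons a w ih =>
    obtain ⟨g, hg⟩ := ih fun b hb => hw b (List.mem_cons_of_mem _ hb)
    obtain rfl := hw a List.mem_cons_self
    refine ⟨letterVal (x a.1.1) (a.1.2, a.2) * g, ?_⟩
    rw [wordVal_cons, hg, map_mul]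
    congr 1
    rcases a with ⟨⟨j, a⟩, _ | _⟩ <;> simp [letterVal, amalgamGen]

/-- A decomposition into at least two monochromatic words denoting a sequence in normal form
denotes a reduced sequence. -/
theorem exists_isReducedSeq (φ : ∀ i, A →* G i) (x : ∀ i, X i → G i)
    {w : List ((Σ i, X i) × Bool)} {L : List (List ((Σ i, X i) × Bool))}
    (hL : IsMonochromaticDecomp w L) (hn : IsNormalSeq φ (L.map (wordVal (amalgamGen φ x))))
    (hlen : L.length ≠ 1) :
    ∃ f : List ((Σ i, X i) × Bool) → Σ i, G i, IsReducedSeq φ (L.map f) ∧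
      ∀ u ∈ L, wordVal (amalgamGen φ x) u = PushoutI.of (f u).1 (f u).2 := by
  obtain ⟨-, hmono, hchain⟩ := hL
  have hex : ∀ u ∈ L, ∃ g : Σ i, G i,
      wordVal (amalgamGen φ x) u = PushoutI.of g.1 g.2 ∧ ∀ a ∈ u, a.1.1 = g.1 := by
    intro u hu
    obtain ⟨-, i, hi⟩ := hmono u hu
    obtain ⟨g, hg⟩ := exists_wordVal_eq_of φ x hi
    exact ⟨⟨i, g⟩, hg, hi⟩
  -- Only a default value for `f` outside `L`.
  have : Nonempty (Σ i, G i) := ⟨⟨0, 1⟩⟩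
  choose! f hf hcol using hex
  refine ⟨f, ⟨?_, ?_⟩, hf⟩
  · rw [List.isChain_map]
    refine hchain.imp_of_mem_imp fun u v hu hv huv heq => ?_
    obtain ⟨a, ha⟩ := List.exists_mem_of_ne_nil u (hmono u hu).1
    obtain ⟨b, hb⟩ := List.exists_mem_of_ne_nil v (hmono v hv).1
    exact huv a ha b hb (by rw [hcol u hu a ha, hcol v hv b hb, heq])
  · intro g hg
    obtain ⟨u, hu, rfl⟩ := List.mem_map.1 hg
    rintro ⟨α, hα⟩
    refine hn.notMem_base (by simpa using hlen) _ (List.mem_map_of_mem hu) ⟨α, ?_⟩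
    rw [hf u hu, ← hα, PushoutI.of_apply_eq_base]

/-- A finitely generated subgroup of an amalgam of finite groups has finitely many essential
vertices. -/
theorem finite_setOf_isEssential [∀ i, Finite (G i)] (φ : ∀ i, A →* G i)
    (hφ : ∀ i, Function.Injective (φ i)) (x : ∀ i, X i → G i)
    {H : Subgroup (PushoutI φ)} (hH : H.FG) : {v | IsEssential φ x H v}.Finite := by
  have : Finite A := Finite.of_injective _ (hφ 0)
  obtain ⟨D, hD, h1D, hpath⟩ := exists_finite_cosets_reflTransGen hH
  set C : Set (PushoutI φ) := {c | ∃ k ∈ H, ∃ d ∈ D, c = k * d}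
  have h1C : 1 ∈ C := ⟨1, one_mem _, 1, h1D, by simp⟩
  refine ((hD.prod (Set.finite_univ (α := A × Σ i, G i))).image fun q =>
    (Quotient.mk'' (q.1 * (PushoutI.base φ q.2.1 * PushoutI.of q.2.2.1 q.2.2.2)) :
      RightCosets H)).subset ?_
  rintro v ⟨p, hp, ⟨L, hL, hn⟩, hv⟩
  have hend := relCayley_isPath_end _ H hp
  obtain ⟨l, hl, rfl⟩ := relCayley_exists_prefix _ H hp hv
  have hmem : wordVal (amalgamGen φ x)
      ((relCayley (amalgamGen φ x) H).pathLabel p) ∈ H := by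
    have := Quotient.exact hend
    simpa using (QuotientGroup.rightRel_apply.1 this)
  generalize (relCayley (amalgamGen φ x) H).pathLabel p = w at hL hl hmem
  obtain ⟨c, ⟨k, hk, d, hd, rfl⟩, α, g, hval⟩ : ∃ c ∈ C, ∃ α, ∃ g : Σ i, G i,
      wordVal (amalgamGen φ x) l = c * (PushoutI.base φ α * PushoutI.of g.1 g.2) := by
    rw [← hL.1] at hl
    rcases hl.exists_of_flatten with rfl | ⟨L', u, t, hL', ht, rfl⟩
    · exact ⟨1, h1C, 1, ⟨0, 1⟩, by simp [wordVal_nil]⟩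
    obtain ⟨-, i, hi⟩ := hL.2.1 u (hL'.subset (by simp))
    obtain ⟨g, hg⟩ := exists_wordVal_eq_of φ x fun a ha => hi a (ht.subset ha)
    rw [wordVal_append, wordVal_flatten, hg]
    suffices ∃ c ∈ C, ∃ α, (L'.map (wordVal (amalgamGen φ x))).prod = c * PushoutI.base φ α by
      obtain ⟨c, hc, α, h⟩ := this
      exact ⟨c, hc, α, ⟨i, g⟩, by rw [h, mul_assoc]⟩
    -- A single syllable may lie in `A`, so it need not be reduced; but then no complete syllable
    -- precedes `u`.
    by_cases hlen : L.length = 1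
    · have : L' = [] := by
        have := hL'.length_le
        rw [← List.length_eq_zero_iff]
        simp only [List.length_append, List.length_singleton] at this
        omega
      subst this
      exact ⟨1, h1C, 1, by simp⟩
    obtain ⟨f, hred, hf⟩ := exists_isReducedSeq φ x hL hn hlen
    have hprod : ∀ M, M <+: L →
        (M.map (wordVal (amalgamGen φ x))).prod = amalgamProd φ (M.map f) := by
      intro M hM
      rw [amalgamProd, List.map_map]
      exact congrArg List.prod (List.map_congr_left fun u hu => hf u (hM.subset hu))
    have hL'' : L' <+: L := (List.prefix_append L' [u]).trans hL'
    obtain ⟨c, hc, α, h⟩ := FactorStep.exists_of_prefix hφ h1C (hpath _ hmem) hred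
      (by rw [one_mul, ← hprod L List.prefix_rfl, ← wordVal_flatten, hL.1]) (hL''.map f)
    exact ⟨c, hc, α, by rw [hprod L' hL'', ← h, one_mul]⟩
  refine ⟨(d, α, g), ⟨hd, Set.mem_univ _⟩, ?_⟩
  -- The factor `k ∈ H` disappears in the right coset.
  refine Quotient.sound ((QuotientGroup.rightRel_apply).2 ?_)
  simpa [hval, mul_assoc] using hk

end NormalCore

theorem mainTheorem3 {A : Type*} [Group A] {G : Fin 2 → Type*} [∀ i, Group (G i)]
    [∀ i, Finite (G i)] (φ : ∀ i, A →* G i) (hφ : ∀ i, Function.Injective (φ i))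
    {X : Fin 2 → Type*} [∀ i, Finite (X i)] (x : ∀ i, X i → G i)
    (R : ∀ i, Set (FreeGroup (X i))) (hR : ∀ i, (R i).Finite)
    (hpres : ∀ i, IsPresentation (x i) (R i))
    (H : Subgroup (Monoid.PushoutI φ)) (hH : H.FG) :
    (normalCore φ x H).IsFinite := by
  have hfin := finite_setOf_isEssential φ hφ x hH
  have : Finite (normalCore φ x H).V := hfin
  refine ⟨this, ?_⟩
  -- An edge is determined by its origin and its label, and the alphabet is finite.
  refine Finite.of_injective
    (fun e : (normalCore φ x H).E => ((normalCore φ x H).init e, (normalCore φ x H).lab e)) ?_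
  intro e e' h
  exact Subtype.ext (Prod.ext (congrArg (fun q => q.1.1) h) (congrArg (fun q => q.2) h))
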